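/- A Steiner triple system (STS) $S$ of order $n$ is a collection of $3$-subsets (blocks) of an $n$-element set of points such that any two distinct points lie in exactly one block. Its point-block incidence matrix is denoted by $W_S$, and its block intersection graph $\Gamma_S$ has the blocks of $S$ as vertices, two distinct blocks being adjacent when they intersect. For an integer $k$, a $k$-flow of $S$ is an integer vector $u$ indexed by the blocks, without zero entries, such that $W_Su=0$ and $\|u\|_\infty+1=k$, where $\|u\|_\infty$ is the maximum of the absolute values of the entries of $u$. For a finite graph $\Gamma$ whose adjacency matrix has the distinct eigenvalues $\theta_0(\Gamma)>\theta_1(\Gamma)>\cdots$, let $$m(i,\Gamma)=\min\{\|u\|_\infty+1 : u \text{ is an integer } \theta_i(\Gamma)\text{-eigenvector of } \Gamma \text{ without zero entries}\}.$$ 1. Let $r\ge 4$ and let $S$ be the Steiner triple system of order $2^r-1$ formed by the supports of the weight-three codewords of a binary Hamming code of length $2^r-1$ (a code with a parity-check matrix whose columns are all the nonzero vectors of $\mathbb F_2^r$, each occurring exactly once). Then the minimum $m(2,\Gamma_S)$ exists and equals $3$. 2. Let $p$ be an odd prime and let $S$ be the Bose Steiner triple system of order $3p$ constructed from the idempotent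 commutative Latin square $(x,y)\mapsto (x+y)/2$ of $\mathbb Z_p$; that is, the points of $S$ are the elements of $\mathbb Z_p\times\mathbb Z_3$ and its blocks are the sets $\{(x,0),(x,1),(x,2)\}$ for $x\in\mathbb Z_p$ and $\{(x,i),(y,i),(\tfrac{x+y}{2},i+1)\}$ for $x\neq y$ in $\mathbb Z_p$ and $i\in\mathbb Z_3$. Then $S$ has a $2$-flow or a $3$-flow. -/

import Mathlib

open Matrix

/-- A Steiner triple system on the finite point set `P`: a collection of 3-subsets (blocks) such
that any two distinct points lie in exactly one block. -/
structure SteinerTripleSystem (P : Type) [Fintype P] [DecidableEq P] where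
  blocks : Finset (Finset P)
  card_block : ∀ T ∈ blocks, T.card = 3
  existsUnique_block : ∀ x y : P, x ≠ y → ∃! T, T ∈ blocks ∧ x ∈ T ∧ y ∈ T

namespace SteinerTripleSystem

variable {P : Type} [Fintype P] [DecidableEq P]

/-- The point-block incidence matrix `W_S`. -/
def incidenceMatrix (S : SteinerTripleSystem P) : Matrix P S.blocks ℤ :=
  Matrix.of fun x T => if x ∈ T.1 then 1 else 0

/-- `S` has a `k`-flow: there is a nowhere-zero integer vector `u` with `W_S u = 0` and
`‖u‖_∞ + 1 = k`. (The norm on a finite power of `ℤ` is the maximum of the absolute values.) -/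
def HasFlow (S : SteinerTripleSystem P) (k : ℕ) : Prop :=
  ∃ u : S.blocks → ℤ, (∀ T, u T ≠ 0) ∧ S.incidenceMatrix *ᵥ u = 0 ∧ ‖u‖ + 1 = (k : ℝ)

/-- The block intersection graph `Γ_S`. -/
def blockGraph (S : SteinerTripleSystem P) : SimpleGraph S.blocks where
  Adj T T' := T ≠ T' ∧ (T.1 ∩ T'.1).Nonempty
  symm := ⟨fun T T' h => ⟨h.1.symm, by rw [Finset.inter_comm]; exact h.2⟩⟩
  loopless := ⟨fun _ h => h.1 rfl⟩

instance (S : SteinerTripleSystem P) : DecidableRel S.blockGraph.Adj := fun T T' =>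
  inferInstanceAs (Decidable (T ≠ T' ∧ (T.1 ∩ T'.1).Nonempty))

end SteinerTripleSystem

namespace SimpleGraph

variable {V : Type} [Fintype V] [DecidableEq V]

/-- `θ` is the eigenvalue `θ_i(Γ)`, where the distinct eigenvalues of the adjacency matrix are
indexed in descending order `θ_0 > θ_1 > ⋯`: exactly `i` distinct eigenvalues exceed `θ`. -/
def IsEigenvalueOfIndex (Γ : SimpleGraph V) [DecidableRel Γ.Adj] (i : ℕ) (θ : ℝ) : Prop :=
  Module.End.HasEigenvalue (Matrix.toLin' (Γ.adjMatrix ℝ)) θ ∧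
    {μ : ℝ | Module.End.HasEigenvalue (Matrix.toLin' (Γ.adjMatrix ℝ)) μ ∧ θ < μ}.ncard = i

/-- The set of numbers `‖u‖_∞ + 1`, for `u` a nowhere-zero integer `θ_i(Γ)`-eigenvector of `Γ`. -/
def nziEigenvectorNumbers (Γ : SimpleGraph V) [DecidableRel Γ.Adj] (i : ℕ) : Set ℕ :=
  {k | ∃ θ : ℝ, Γ.IsEigenvalueOfIndex i θ ∧ ∃ u : V → ℤ, (∀ v, u v ≠ 0) ∧
    Module.End.HasEigenvector (Matrix.toLin' (Γ.adjMatrix ℝ)) θ (fun v => (u v : ℝ)) ∧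
    ‖u‖ + 1 = (k : ℝ)}

/-- `m(i, Γ) = m`: the minimum of `‖u‖_∞ + 1` over all nowhere-zero integer
`θ_i(Γ)`-eigenvectors `u` exists and equals `m`. -/
def IsMinNZI (Γ : SimpleGraph V) [DecidableRel Γ.Adj] (i m : ℕ) : Prop :=
  IsLeast (Γ.nziEigenvectorNumbers i) m

end SimpleGraph

/-- `H` is a parity-check matrix of a binary Hamming code of length `2 ^ r - 1`: its columns are
all the nonzero vectors of `𝔽₂ ^ r`, each once, in any order. -/
def IsHammingCheckMatrix {r : ℕ} (H : Matrix (Fin r) (Fin (2 ^ r - 1)) (ZMod 2)) : Prop :=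
  Function.Injective H.col ∧ Set.range H.col = {v | v ≠ 0}

/-- The binary code with parity-check matrix `H`. -/
def codeOfCheckMatrix {r n : ℕ} (H : Matrix (Fin r) (Fin n) (ZMod 2)) :
    Submodule (ZMod 2) (Fin n → ZMod 2) :=
  LinearMap.ker (Matrix.toLin' H)

/-- The support of a word. -/
def wordSupport {n : ℕ} (c : Fin n → ZMod 2) : Finset (Fin n) :=
  Finset.univ.filter fun j => c j ≠ 0

open Classical in
/-- The supports of the codewords of weight three. -/
noncomputable def weightThreeSupports {r n : ℕ} (H : Matrix (Fin r) (Fin n) (ZMod 2)) :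
    Finset (Finset (Fin n)) :=
  Finset.univ.filter fun T => ∃ c ∈ codeOfCheckMatrix H, hammingNorm c = 3 ∧ T = wordSupport c

theorem mem_weightThreeSupports {r n : ℕ} (H : Matrix (Fin r) (Fin n) (ZMod 2))
    (T : Finset (Fin n)) :
    T ∈ weightThreeSupports H ↔ T.card = 3 ∧ ∑ j ∈ T, H.col j = 0 := by
  have key : ∀ c : Fin n → ZMod 2, H *ᵥ c = ∑ j ∈ wordSupport c, H.col j := by
    intro c
    ext i
    simp only [Matrix.mulVec, dotProduct, Finset.sum_apply, Matrix.col_apply, wordSupport,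
      Finset.sum_filter]
    refine Finset.sum_congr rfl fun j _ => ?_
    generalize H i j = a
    generalize c j = b
    revert a b
    decide
  simp only [weightThreeSupports, Finset.mem_filter, Finset.mem_univ, true_and,
    codeOfCheckMatrix, LinearMap.mem_ker, Matrix.toLin'_apply]
  constructor
  · rintro ⟨c, hc, h3, rfl⟩
    exact ⟨h3, by rw [← key, hc]⟩
  · rintro ⟨h3, hs⟩
    have hT : wordSupport (fun j => if j ∈ T then (1 : ZMod 2) else 0) = T := by
      ext j; simp [wordSupport]
    refine ⟨fun j => if j ∈ T then 1 else 0, ?_, ?_, hT.symm⟩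
    · rw [key, hT, hs]
    · change (wordSupport _).card = 3
      rw [hT, h3]

/-- The Hamming (projective) Steiner triple system of order `2 ^ r - 1`. -/
noncomputable def hammingSTS {r : ℕ} (H : Matrix (Fin r) (Fin (2 ^ r - 1)) (ZMod 2))
    (hH : IsHammingCheckMatrix H) : SteinerTripleSystem (Fin (2 ^ r - 1)) where
  blocks := weightThreeSupports H
  card_block T hT := ((mem_weightThreeSupports H T).1 hT).1
  existsUnique_block x y hxy := by
    obtain ⟨hinj, hrange⟩ := hH
    have hself : ∀ v : Fin r → ZMod 2, v + v = 0 := fun v => by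
      ext i; exact CharTwo.add_self_eq_zero _
    have hne : ∀ j, H.col j ≠ 0 := fun j => by
      have : H.col j ∈ {v | v ≠ 0} := hrange ▸ Set.mem_range_self j
      exact this
    have hsum : H.col x + H.col y ∈ Set.range H.col := by
      rw [hrange]
      intro h
      apply hxy
      apply hinj
      calc H.col x = H.col x + (H.col y + H.col y) := by rw [hself, add_zero]
        _ = (H.col x + H.col y) + H.col y := by rw [add_assoc]
        _ = H.col y := by rw [h, zero_add]
    obtain ⟨z, hz⟩ := hsum
    have hzx : z ≠ x := by
      rintro rfl
      exact hne y (by simpa using hz)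
    have hzy : z ≠ y := by
      rintro rfl
      exact hne x (by simpa using hz)
    refine ⟨{x, y, z}, ⟨(mem_weightThreeSupports H _).2 ⟨?_, ?_⟩, by simp, by simp⟩, ?_⟩
    · exact Finset.card_eq_three.2 ⟨x, y, z, hxy, hzx.symm, hzy.symm, rfl⟩
    · rw [Finset.sum_insert (by simp [hxy, hzx.symm]), Finset.sum_pair hzy.symm, hz, ← add_assoc,
        hself]
    · rintro T ⟨hT, hxT, hyT⟩
      obtain ⟨h3, hs⟩ := (mem_weightThreeSupports H T).1 hT
      have hsub : ({x, y} : Finset _) ⊆ T := by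
        intro a ha
        simp only [Finset.mem_insert, Finset.mem_singleton] at ha
        rcases ha with rfl | rfl <;> assumption
      have hcard : (T \ {x, y}).card = 1 := by
        rw [Finset.card_sdiff_of_subset hsub, h3, Finset.card_pair hxy]
      obtain ⟨w, hw⟩ := Finset.card_eq_one.1 hcard
      have hsplit := Finset.sum_sdiff (f := H.col) hsub
      rw [hw, Finset.sum_singleton, Finset.sum_pair hxy, hs, ← hz] at hsplit
      have hwz : w = z := by
        apply hinj
        calc H.col w = H.col w + (H.col z + H.col z) := by rw [hself, add_zero]
          _ = (H.col w + H.col z) + H.col z := by rw [add_assoc]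
          _ = H.col z := by rw [hsplit, zero_add]
      rw [← Finset.sdiff_union_of_subset hsub, hw, hwz]
      ext a
      simp only [Finset.mem_union, Finset.mem_singleton, Finset.mem_insert]
      tauto

/-- The blocks of Bose's construction on `ℤ_p × ℤ_3` from the idempotent commutative Latin square
`(x, y) ↦ (x + y) / 2` of `ℤ_p`. -/
def boseBlocks (p : ℕ) [Fact p.Prime] : Finset (Finset (ZMod p × ZMod 3)) :=
  (Finset.univ.image fun x : ZMod p => {(x, 0), (x, 1), (x, 2)}) ∪
  ((Finset.univ.filter fun t : ZMod p × ZMod p × ZMod 3 => t.1 ≠ t.2.1).image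
    fun t => {(t.1, t.2.2), (t.2.1, t.2.2), ((t.1 + t.2.1) / 2, t.2.2 + 1)})

theorem mem_boseBlocks (p : ℕ) [Fact p.Prime] (T : Finset (ZMod p × ZMod 3)) :
    T ∈ boseBlocks p ↔ (∃ x : ZMod p, T = {(x, 0), (x, 1), (x, 2)}) ∨
      ∃ (x y : ZMod p) (i : ZMod 3), x ≠ y ∧ T = {(x, i), (y, i), ((x + y) / 2, i + 1)} := by
  simp only [boseBlocks, Finset.mem_union, Finset.mem_image, Finset.mem_filter, Finset.mem_univ,
    true_and, Prod.exists]
  constructor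
  · rintro (⟨x, rfl⟩ | ⟨x, y, i, h, rfl⟩)
    · exact Or.inl ⟨x, rfl⟩
    · exact Or.inr ⟨x, y, i, h, rfl⟩
  · rintro (⟨x, rfl⟩ | ⟨x, y, i, h, rfl⟩)
    · exact Or.inl ⟨x, rfl⟩
    · exact Or.inr ⟨x, y, i, h, rfl⟩

theorem mem_vertical {p : ℕ} (x : ZMod p) (q : ZMod p × ZMod 3) :
    q ∈ ({(x, 0), (x, 1), (x, 2)} : Finset (ZMod p × ZMod 3)) ↔ q.1 = x := by
  obtain ⟨a, i⟩ := q
  have h : ∀ i : ZMod 3, i = 0 ∨ i = 1 ∨ i = 2 := by decide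
  simp only [Finset.mem_insert, Finset.mem_singleton, Prod.mk.injEq]
  have := h i
  tauto

theorem existsUnique_boseBlocks (p : ℕ) [Fact p.Prime] (hp : p ≠ 2) (x y : ZMod p × ZMod 3)
    (hxy : x ≠ y) : ∃! T, T ∈ boseBlocks p ∧ x ∈ T ∧ y ∈ T := by
  have h2 : (2 : ZMod p) ≠ 0 := by
    intro h
    have : ((2 : ℕ) : ZMod p) = 0 := by exact_mod_cast h
    rw [ZMod.natCast_eq_zero_iff] at this
    exact hp ((Nat.prime_dvd_prime_iff_eq Fact.out Nat.prime_two).1 this)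
  have hn1 : ∀ i : ZMod 3, i + 1 ≠ i := by decide
  have hn2 : ∀ i j : ZMod 3, j = i + 1 → i ≠ j + 1 := by decide
  have hcases : ∀ i j : ZMod 3, j = i ∨ j = i + 1 ∨ i = j + 1 := by decide
  have hcancel : ∀ i j : ZMod 3, i + 1 = j + 1 → i = j := by decide
  have consec : ∀ (a b : ZMod p) (i : ZMod 3),
      ∃! T, T ∈ boseBlocks p ∧ (a, i) ∈ T ∧ (b, i + 1) ∈ T := by
    intro a b i
    by_cases hab : a = b
    · subst hab
      refine ⟨{(a, 0), (a, 1), (a, 2)}, ⟨(mem_boseBlocks p _).2 (Or.inl ⟨a, rfl⟩),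
        (mem_vertical _ _).2 rfl, (mem_vertical _ _).2 rfl⟩, ?_⟩
      rintro T ⟨hT, h1, h3⟩
      rcases (mem_boseBlocks p T).1 hT with ⟨c, rfl⟩ | ⟨c, d, k, hcd, rfl⟩
      · have hac : a = c := (mem_vertical _ _).1 h1
        rw [hac]
      · exfalso
        simp only [Finset.mem_insert, Finset.mem_singleton, Prod.mk.injEq] at h1 h3
        have e1 : a = (c + d) / 2 → a = c → c = d := fun h h' => by
          rw [eq_div_iff h2] at h; linear_combination h - 2 * h'
        have e2 : a = (c + d) / 2 → a = d → c = d := fun h h' => by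
          rw [eq_div_iff h2] at h; linear_combination -h + 2 * h'
        grind
    · have hne : a ≠ 2 * b - a := fun h => hab (mul_left_cancel₀ h2 (by linear_combination h))
      have hmid : (a + (2 * b - a)) / 2 = b := by field_simp; ring
      refine ⟨{(a, i), (2 * b - a, i), ((a + (2 * b - a)) / 2, i + 1)},
        ⟨(mem_boseBlocks p _).2 (Or.inr ⟨_, _, _, hne, rfl⟩), by simp, by rw [hmid]; simp⟩, ?_⟩
      rintro T ⟨hT, h1, h3⟩
      rcases (mem_boseBlocks p T).1 hT with ⟨c, rfl⟩ | ⟨c, d, k, hcd, rfl⟩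
      · exact absurd (((mem_vertical _ _).1 h1).trans ((mem_vertical _ _).1 h3).symm) hab
      · simp only [Finset.mem_insert, Finset.mem_singleton, Prod.mk.injEq] at h1 h3
        have hik : i = k ∧ (a = c ∨ a = d) ∧ b = (c + d) / 2 := by grind
        obtain ⟨rfl, hac, hb⟩ := hik
        rw [hmid]
        have hb' := (eq_div_iff h2).1 hb
        rcases hac with rfl | rfl
        · have : 2 * b - a = d := by linear_combination hb'
          rw [this, ← hb]
        · have : 2 * b - a = c := by linear_combination hb'
          rw [this, ← hb]
          ext q
          simp only [Finset.mem_insert, Finset.mem_singleton]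
          tauto
  obtain ⟨a, i⟩ := x
  obtain ⟨b, j⟩ := y
  rcases hcases i j with rfl | rfl | rfl
  · have hab : a ≠ b := fun h => hxy (by rw [h])
    refine ⟨{(a, j), (b, j), ((a + b) / 2, j + 1)},
      ⟨(mem_boseBlocks p _).2 (Or.inr ⟨a, b, j, hab, rfl⟩), by simp, by simp⟩, ?_⟩
    rintro T ⟨hT, h1, h3⟩
    rcases (mem_boseBlocks p T).1 hT with ⟨c, rfl⟩ | ⟨c, d, k, hcd, rfl⟩
    · exact absurd (((mem_vertical _ _).1 h1).trans ((mem_vertical _ _).1 h3).symm) hab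
    · simp only [Finset.mem_insert, Finset.mem_singleton, Prod.mk.injEq] at h1 h3
      have hjk : j = k ∧ ((a = c ∧ b = d) ∨ (a = d ∧ b = c)) := by grind
      obtain ⟨rfl, ⟨rfl, rfl⟩ | ⟨rfl, rfl⟩⟩ := hjk
      · rfl
      · rw [add_comm b a]
        ext q
        simp only [Finset.mem_insert, Finset.mem_singleton]
        tauto
  · exact consec a b i
  · obtain ⟨T, ⟨hT, h1, h3⟩, hu⟩ := consec b a j
    exact ⟨T, ⟨hT, h3, h1⟩, fun T' h => hu T' ⟨h.1, h.2.2, h.2.1⟩⟩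

/-- The Bose Steiner triple system of order `3 p`, `p` an odd prime. -/
def boseSTS (p : ℕ) [Fact p.Prime] (hp : p ≠ 2) : SteinerTripleSystem (ZMod p × ZMod 3) where
  blocks := boseBlocks p
  card_block T hT := by
    have hn1 : ∀ i : ZMod 3, i ≠ i + 1 := by decide
    rcases (mem_boseBlocks p T).1 hT with ⟨c, rfl⟩ | ⟨c, d, k, hcd, rfl⟩
    · refine Finset.card_eq_three.2 ⟨_, _, _, ?_, ?_, ?_, rfl⟩ <;>
        simp only [ne_eq, Prod.mk.injEq, true_and] <;> decide
    · refine Finset.card_eq_three.2 ⟨_, _, _, ?_, ?_, ?_, rfl⟩ <;>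
        simp [hcd]
  existsUnique_block := existsUnique_boseBlocks p hp

/-! Let `W` be the incidence matrix of an STS on `n` points and `ρ = (n - 1) / 2` the number of
blocks through a point. Then `Wᵀ W = A + 3`, with `A` the adjacency matrix of the block graph, and
`W Wᵀ = (ρ - 1) I + J`. Hence the possible eigenvalues of `A` are `ρ - 4 + n`, `ρ - 4` and `-3`, the
last with eigenspace `ker W`. For `n > 3` they decrease in this order, so once a flow exists, `θ₂ =
-3` and its nowhere-zero integer eigenvectors are exactly the flows. In the Hamming case `ρ` is odd,
and an odd number of signs cannot sum to zero; so 3 is a lower bound (`three_le_of_hasFlow`).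

It remains to weight the blocks by `±1, ±2` with sum zero at every point. A weighting is handled as
a function of pairs of points, constant on each block (`exists_flow_of_pairFunction`).

For Hamming systems the blocks are the lines of a projective space over `𝔽₂`. The lines inside a
hyperplane and those outside it are balanced separately (`IsLineFlow.join`, `exists_isAffineFlow`),
which gives an induction from an explicit table for `r = 4`.

For Bose systems the weight of `{(x,i), (y,i), ((x+y)/2, i+1)}` is a function of `x - y` and `x + y`
alone, the same on all three levels. This reduces the point conditions to one identity on `ℤ_p`,
solved in `exists_bose_weights`. -/

namespace SteinerTripleSystem

/-! ### Flows as functions of pairs, and the parity bound -/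

section

variable {P : Type} [Fintype P] [DecidableEq P] (S : SteinerTripleSystem P)

theorem card_blocks_through_pair {x y : P} (hxy : x ≠ y) :
    (Finset.univ.filter fun T : S.blocks => x ∈ T.1 ∧ y ∈ T.1).card = 1 := by
  obtain ⟨T, ⟨hT, hx, hy⟩, hu⟩ := S.existsUnique_block x y hxy
  refine Finset.card_eq_one.2 ⟨⟨T, hT⟩, ?_⟩
  ext T'
  simp only [Finset.mem_filter, Finset.mem_univ, true_and, Finset.mem_singleton]
  constructor
  · rintro ⟨h1, h2⟩
    exact Subtype.ext (hu T'.1 ⟨T'.2, h1, h2⟩)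
  · rintro rfl
    exact ⟨hx, hy⟩

/-- Each block through `x` is counted twice when one sums a function of pairs which is constant on
the blocks over the pairs containing `x`. -/
theorem two_mul_incidenceMatrix_mulVec {F : P → P → ℤ} {u : S.blocks → ℤ} (h0 : ∀ x, F x x = 0)
    (hu : ∀ T : S.blocks, ∀ x ∈ T.1, ∀ y ∈ T.1, x ≠ y → F x y = u T) (x : P) :
    2 * (S.incidenceMatrix *ᵥ u) x = ∑ y, F x y := by
  have h1 : ∀ T : S.blocks, 2 * (S.incidenceMatrix x T * u T) =
      ∑ y, if x ∈ T.1 ∧ y ∈ T.1 then F x y else 0 := by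
    intro T
    by_cases hx : x ∈ T.1
    · have h2 : (T.1.erase x).card = 2 := by
        rw [Finset.card_erase_of_mem hx, S.card_block _ T.2]
      have h3 : ∑ y ∈ T.1.erase x, F x y = 2 * u T := by
        rw [Finset.sum_congr rfl fun y hy => hu T x hx y (Finset.mem_of_mem_erase hy)
          (Finset.ne_of_mem_erase hy).symm, Finset.sum_const, h2]
        simp
      rw [Finset.sum_erase _ (h0 x)] at h3
      simp [incidenceMatrix, hx, h3]
    · simp [incidenceMatrix, hx]
  simp only [Matrix.mulVec, dotProduct, Finset.mul_sum]
  rw [Finset.sum_congr rfl fun T _ => h1 T, Finset.sum_comm]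
  refine Finset.sum_congr rfl fun y _ => ?_
  by_cases hxy : x = y
  · subst hxy; simp [h0]
  · rw [← Finset.sum_filter, Finset.sum_const, S.card_blocks_through_pair hxy, one_smul]

theorem two_mul_replication (x : P) :
    2 * (S.incidenceMatrix *ᵥ 1) x = (Fintype.card P : ℤ) - 1 := by
  rw [S.two_mul_incidenceMatrix_mulVec (F := fun x y => if x = y then 0 else 1) (by simp)
    (fun T a _ b _ hab => by simp [hab])]
  have : ∀ y, (if x = y then (0 : ℤ) else 1) = 1 - if x = y then 1 else 0 := by
    intro y; split <;> simp
  simp [this, Finset.sum_sub_distrib]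

theorem exists_flow_of_pairFunction (F : P → P → ℤ) (h0 : ∀ x, F x x = 0)
    (hsum : ∀ x, ∑ y, F x y = 0)
    (hB : ∀ T ∈ S.blocks, ∃ v : ℤ, v ≠ 0 ∧ |v| ≤ 2 ∧ ∀ x ∈ T, ∀ y ∈ T, x ≠ y → F x y = v) :
    ∃ u : S.blocks → ℤ, (∀ T, u T ≠ 0) ∧ (∀ T, |u T| ≤ 2) ∧ S.incidenceMatrix *ᵥ u = 0 := by
  have hB' : ∀ T : S.blocks, ∃ v : ℤ, v ≠ 0 ∧ |v| ≤ 2 ∧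
      ∀ x ∈ T.1, ∀ y ∈ T.1, x ≠ y → F x y = v := fun T => hB T.1 T.2
  choose u hu0 hu2 huF using hB'
  refine ⟨u, hu0, hu2, ?_⟩
  ext x
  have := S.two_mul_incidenceMatrix_mulVec h0 huF x
  rw [hsum] at this
  simpa using this

theorem hasFlow_two_or_three_of_abs_le [Nontrivial P] {u : S.blocks → ℤ} (h0 : ∀ T, u T ≠ 0)
    (h2 : ∀ T, |u T| ≤ 2) (hW : S.incidenceMatrix *ᵥ u = 0) : S.HasFlow 2 ∨ S.HasFlow 3 := by
  -- At least one block is needed: on an empty index set the norm would be 0.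
  obtain ⟨x, y, hxy⟩ := exists_pair_ne P
  obtain ⟨T₀, ⟨hT₀, -⟩, -⟩ := S.existsUnique_block x y hxy
  have hle : ∀ {c : ℤ}, 0 ≤ c → (∀ T, |u T| ≤ c) → ‖u‖ ≤ c := by
    intro c hc h
    refine (pi_norm_le_iff_of_nonneg (by exact_mod_cast hc)).2 fun T => ?_
    rw [Int.norm_eq_abs]
    exact_mod_cast h T
  have hge : ∀ T, ((|u T| : ℤ) : ℝ) ≤ ‖u‖ := by
    intro T
    have := norm_le_pi_norm u T
    rwa [Int.norm_eq_abs, ← Int.cast_abs] at this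
  have hpos : ∀ T, 1 ≤ |u T| := fun T => Int.one_le_abs (h0 T)
  by_cases h : ∃ T, |u T| = 2
  · obtain ⟨T, hT⟩ := h
    right
    refine ⟨u, h0, hW, ?_⟩
    have h1 := hle (by norm_num) h2
    have h3 := hge T
    rw [hT] at h3
    push_cast at *
    linarith
  · push Not at h
    left
    refine ⟨u, h0, hW, ?_⟩
    have h1 := hle (c := 1) (by norm_num) fun T => by have := h T; have := h2 T; omega
    have h3 := hge ⟨T₀, hT₀⟩
    have h4 : (1 : ℝ) ≤ ((|u ⟨T₀, hT₀⟩| : ℤ) : ℝ) := by exact_mod_cast hpos _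
    push_cast at *
    linarith

/-- Here `m` is the number of blocks through each point. If all entries were `±1`, the sum at `x`
would have the parity of `m`. -/
theorem three_le_of_hasFlow (x : P) {m : ℕ} (hm : Odd m) (hc : Fintype.card P = 2 * m + 1)
    {k : ℕ} (hk : S.HasFlow k) : 3 ≤ k := by
  obtain ⟨u, h0, hW, hn⟩ := hk
  by_contra hlt
  have hk2 : (k : ℝ) ≤ 2 := by exact_mod_cast (by omega : k ≤ 2)
  have hle : ∀ T, |u T| ≤ 1 := by
    intro T
    have := norm_le_pi_norm u T
    rw [Int.norm_eq_abs, ← Int.cast_abs] at this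
    exact_mod_cast (by linarith : ((|u T| : ℤ) : ℝ) ≤ 1)
  have hodd : ∀ T, ∃ t, u T = 2 * t + 1 := by
    intro T
    have h1 := h0 T
    have h2 := abs_le.1 (hle T)
    exact ⟨(u T - 1) / 2, by omega⟩
  choose t ht using hodd
  have hu : u = (2 : ℤ) • t + 1 := by
    ext T; simpa using ht T
  have h1 := congrFun hW x
  rw [hu, Matrix.mulVec_add, Matrix.mulVec_smul] at h1
  have h2 := S.two_mul_replication x
  rw [hc] at h2
  obtain ⟨l, rfl⟩ := hm
  simp only [Pi.add_apply, Pi.smul_apply, smul_eq_mul, Pi.zero_apply] at h1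
  push_cast at h2
  omega

/-! ### Spectrum of the block intersection graph -/

/-- The incidence matrix over the reals. -/
def realIncidenceMatrix : Matrix P S.blocks ℝ :=
  Matrix.of fun x T => if x ∈ T.1 then 1 else 0

theorem adjMatrix_blockGraph : S.blockGraph.adjMatrix ℝ =
    S.realIncidenceMatrixᵀ * S.realIncidenceMatrix - (3 : ℝ) • (1 : Matrix S.blocks S.blocks ℝ) := by
  ext T T'
  have hcount : (S.realIncidenceMatrixᵀ * S.realIncidenceMatrix) T T' = ((T.1 ∩ T'.1).card : ℝ) := by
    simp only [Matrix.mul_apply, Matrix.transpose_apply, realIncidenceMatrix, Matrix.of_apply,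
      ← ite_and, mul_ite, mul_one, mul_zero]
    rw [Finset.sum_boole]
    congr 2
    ext x
    simp [and_comm]
  rw [Matrix.sub_apply, hcount, SimpleGraph.adjMatrix_apply]
  by_cases h : T = T'
  · subst h
    simp [blockGraph, S.card_block _ T.2]
  · have h1 : (T.1 ∩ T'.1).card ≤ 1 := by
      refine Finset.card_le_one.2 fun a ha b hb => ?_
      by_contra hab
      rw [Finset.mem_inter] at ha hb
      exact h (Subtype.ext ((S.existsUnique_block a b hab).unique ⟨T.2, ha.1, hb.1⟩
        ⟨T'.2, ha.2, hb.2⟩))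
    by_cases h2 : (T.1 ∩ T'.1).Nonempty
    · have : (T.1 ∩ T'.1).card = 1 := le_antisymm h1 h2.card_pos
      simp [blockGraph, h, h2, this]
    · have h3 : T.1 ∩ T'.1 = ∅ := Finset.not_nonempty_iff_eq_empty.1 h2
      simp [blockGraph, h, h3]

theorem realIncidenceMatrix_mul_transpose :
    S.realIncidenceMatrix * S.realIncidenceMatrixᵀ =
      (((Fintype.card P : ℝ) - 1) / 2 - 1) • (1 : Matrix P P ℝ) + Matrix.of fun _ _ => 1 := by
  ext x y
  have hcount : (S.realIncidenceMatrix * S.realIncidenceMatrixᵀ) x y =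
      ((Finset.univ.filter fun T : S.blocks => x ∈ T.1 ∧ y ∈ T.1).card : ℝ) := by
    simp only [Matrix.mul_apply, Matrix.transpose_apply, realIncidenceMatrix, Matrix.of_apply,
      ← ite_and, mul_ite, mul_one, mul_zero]
    rw [Finset.sum_boole]
    congr 2
    ext T
    simp [and_comm]
  rw [hcount]
  by_cases h : x = y
  · subst h
    have h1 := S.two_mul_replication x
    have h2 : (S.incidenceMatrix *ᵥ 1) x =
        ((Finset.univ.filter fun T : S.blocks => x ∈ T.1 ∧ x ∈ T.1).card : ℤ) := by
      simp [Matrix.mulVec, dotProduct, incidenceMatrix]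
    rw [h2] at h1
    have h3 : 2 * ((Finset.univ.filter fun T : S.blocks => x ∈ T.1 ∧ x ∈ T.1).card : ℝ) =
        (Fintype.card P : ℝ) - 1 := by exact_mod_cast h1
    simp only [Matrix.add_apply, Matrix.smul_apply, Matrix.one_apply_eq, Matrix.of_apply,
      smul_eq_mul]
    linarith
  · rw [S.card_blocks_through_pair h]
    simp [h]

theorem realIncidenceMatrix_mulVec_transpose_mulVec (w : P → ℝ) (x : P) :
    (S.realIncidenceMatrix *ᵥ (S.realIncidenceMatrixᵀ *ᵥ w)) x =
      (((Fintype.card P : ℝ) - 1) / 2 - 1) * w x + ∑ y, w y := by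
  rw [Matrix.mulVec_mulVec, realIncidenceMatrix_mul_transpose, Matrix.add_mulVec,
    Matrix.smul_mulVec, Matrix.one_mulVec]
  simp [Matrix.mulVec, dotProduct]

theorem toLin_adjMatrix_apply (v : S.blocks → ℝ) :
    Matrix.toLin' (S.blockGraph.adjMatrix ℝ) v =
      S.realIncidenceMatrixᵀ *ᵥ (S.realIncidenceMatrix *ᵥ v) - (3 : ℝ) • v := by
  rw [Matrix.toLin'_apply, adjMatrix_blockGraph, Matrix.sub_mulVec, Matrix.smul_mulVec,
    Matrix.one_mulVec, Matrix.mulVec_mulVec]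

/-- `Wᵀ W v = 0` forces `W v ⬝ᵥ W v = 0`, hence `W v = 0`. -/
theorem toLin_adjMatrix_eq_neg_three_smul_iff (v : S.blocks → ℝ) :
    Matrix.toLin' (S.blockGraph.adjMatrix ℝ) v = (-3 : ℝ) • v ↔
      S.realIncidenceMatrix *ᵥ v = 0 := by
  rw [toLin_adjMatrix_apply, neg_smul, sub_eq_add_neg, add_eq_right]
  constructor
  · intro h
    have h1 : (S.realIncidenceMatrix *ᵥ v) ⬝ᵥ (S.realIncidenceMatrix *ᵥ v) = 0 := by
      rw [Matrix.dotProduct_mulVec, ← Matrix.mulVec_transpose, h, zero_dotProduct]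
    exact dotProduct_self_eq_zero.1 h1
  · intro h
    rw [h, Matrix.mulVec_zero]

theorem realIncidenceMatrix_mulVec_intCast_eq_zero_iff (u : S.blocks → ℤ) :
    S.realIncidenceMatrix *ᵥ (fun T => (u T : ℝ)) = 0 ↔ S.incidenceMatrix *ᵥ u = 0 := by
  have h : ∀ x, (S.realIncidenceMatrix *ᵥ (fun T => (u T : ℝ))) x =
      ((S.incidenceMatrix *ᵥ u) x : ℝ) := by
    intro x
    simp [Matrix.mulVec, dotProduct, realIncidenceMatrix, incidenceMatrix]
  simp only [funext_iff, h, Pi.zero_apply, Int.cast_eq_zero]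

/-- Away from `-3`, `w = W v` is an eigenvector of `W Wᵀ = (ρ - 1) I + J`. Its coordinate sum either
vanishes, leaving `ρ - 1`, or can be cancelled after summing the eigenvector equation over all
points. -/
theorem eigenvalue_blockGraph_cases {μ : ℝ}
    (h : Module.End.HasEigenvalue (Matrix.toLin' (S.blockGraph.adjMatrix ℝ)) μ) :
    μ = -3 ∨ μ = ((Fintype.card P : ℝ) - 1) / 2 - 4 ∨
      μ = ((Fintype.card P : ℝ) - 1) / 2 - 4 + Fintype.card P := by
  obtain ⟨v, hv⟩ := h.exists_hasEigenvector
  have hne := hv.2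
  have hv1 := hv.apply_eq_smul
  by_cases hμ : μ = -3
  · exact Or.inl hμ
  right
  rw [toLin_adjMatrix_apply, sub_eq_iff_eq_add, ← add_smul] at hv1
  set w := S.realIncidenceMatrix *ᵥ v with hw
  have hw0 : w ≠ 0 := by
    intro h0
    rw [h0, Matrix.mulVec_zero, eq_comm, smul_eq_zero] at hv1
    rcases hv1 with h1 | h1
    · exact hμ (by linarith)
    · exact hne h1
  have hx : ∀ x, (((Fintype.card P : ℝ) - 1) / 2 - 1) * w x + ∑ y, w y = (μ + 3) * w x := by
    intro x
    rw [← realIncidenceMatrix_mulVec_transpose_mulVec, hv1, Matrix.mulVec_smul, ← hw]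
    simp
  by_cases hs : ∑ y, w y = 0
  · left
    obtain ⟨x, hx0⟩ := Function.ne_iff.1 hw0
    have h1 := hx x
    rw [hs, add_zero] at h1
    have h2 := mul_right_cancel₀ hx0 h1
    linarith
  · right
    have h1 : ∑ x, ((((Fintype.card P : ℝ) - 1) / 2 - 1) * w x + ∑ y, w y) =
        ∑ x, (μ + 3) * w x := Finset.sum_congr rfl fun x _ => hx x
    rw [Finset.sum_add_distrib, ← Finset.mul_sum, ← Finset.mul_sum, Finset.sum_const,
      Finset.card_univ, nsmul_eq_mul, ← add_mul] at h1
    have h2 := mul_right_cancel₀ hs h1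
    linarith

/-- `Wᵀ` carries eigenvectors of `W Wᵀ` to eigenvectors of `Wᵀ W`; a nonzero eigenvalue keeps the
image nonzero. -/
theorem hasEigenvalue_of_transpose_mulVec {w : P → ℝ} (hw : w ≠ 0) {c : ℝ} (hc : c ≠ 0)
    (h : ∀ x, (((Fintype.card P : ℝ) - 1) / 2 - 1) * w x + ∑ y, w y = c * w x) :
    Module.End.HasEigenvalue (Matrix.toLin' (S.blockGraph.adjMatrix ℝ)) (c - 3) := by
  have h1 : S.realIncidenceMatrix *ᵥ (S.realIncidenceMatrixᵀ *ᵥ w) = c • w := by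
    ext x
    rw [realIncidenceMatrix_mulVec_transpose_mulVec, h]
    simp
  refine Module.End.hasEigenvalue_of_hasEigenvector
    (x := S.realIncidenceMatrixᵀ *ᵥ w) (Module.End.hasEigenvector_iff.2 ⟨?_, ?_⟩)
  · rw [Module.End.mem_eigenspace_iff, toLin_adjMatrix_apply, h1, Matrix.mulVec_smul, sub_smul]
  · intro h0
    rw [h0, Matrix.mulVec_zero, eq_comm, smul_eq_zero] at h1
    exact h1.elim hc hw

theorem hasEigenvalue_blockGraph_second [Nontrivial P] (hP : 3 < Fintype.card P) :
    Module.End.HasEigenvalue (Matrix.toLin' (S.blockGraph.adjMatrix ℝ))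
      (((Fintype.card P : ℝ) - 1) / 2 - 4) := by
  obtain ⟨a, b, hab⟩ := exists_pair_ne P
  have hP' : (3 : ℝ) < Fintype.card P := by exact_mod_cast hP
  have := S.hasEigenvalue_of_transpose_mulVec (w := Pi.single a 1 - Pi.single b 1)
    (c := ((Fintype.card P : ℝ) - 1) / 2 - 1)
    (fun h => by simpa [hab] using congrFun h a) (by linarith)
    (fun x => by simp [Finset.sum_sub_distrib])
  convert this using 1
  ring

theorem hasEigenvalue_blockGraph_first [Nontrivial P] :
    Module.End.HasEigenvalue (Matrix.toLin' (S.blockGraph.adjMatrix ℝ))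
      (((Fintype.card P : ℝ) - 1) / 2 - 4 + Fintype.card P) := by
  have hP' : (1 : ℝ) < Fintype.card P := by exact_mod_cast Fintype.one_lt_card
  have := S.hasEigenvalue_of_transpose_mulVec (w := 1)
    (c := ((Fintype.card P : ℝ) - 1) / 2 - 1 + Fintype.card P) one_ne_zero (by linarith)
    (fun x => by simp)
  convert this using 1
  ring

/-- The hypothesis `h3` has content: `W` may have trivial kernel, as for the Fano plane. -/
theorem isEigenvalueOfIndex_two_iff [Nontrivial P] (hP : 3 < Fintype.card P)
    (h3 : Module.End.HasEigenvalue (Matrix.toLin' (S.blockGraph.adjMatrix ℝ)) (-3)) (θ : ℝ) :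
    S.blockGraph.IsEigenvalueOfIndex 2 θ ↔ θ = -3 := by
  have hP' : (3 : ℝ) < Fintype.card P := by exact_mod_cast hP
  set n : ℝ := (Fintype.card P : ℝ) with hn
  have hev : ∀ μ : ℝ, Module.End.HasEigenvalue (Matrix.toLin' (S.blockGraph.adjMatrix ℝ)) μ ↔
      μ = -3 ∨ μ = (n - 1) / 2 - 4 ∨ μ = (n - 1) / 2 - 4 + n := fun μ =>
    ⟨S.eigenvalue_blockGraph_cases, by
      rintro (rfl | rfl | rfl)
      · exact h3
      · exact S.hasEigenvalue_blockGraph_second hP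
      · exact S.hasEigenvalue_blockGraph_first⟩
  simp only [SimpleGraph.IsEigenvalueOfIndex, hev]
  constructor
  · rintro ⟨rfl | rfl | rfl, h⟩
    · rfl
    · have : {μ : ℝ | (μ = -3 ∨ μ = (n - 1) / 2 - 4 ∨ μ = (n - 1) / 2 - 4 + n) ∧
          (n - 1) / 2 - 4 < μ} ⊆ {(n - 1) / 2 - 4 + n} := by
        rintro μ ⟨rfl | rfl | rfl, hμ⟩
        · linarith
        · exact absurd hμ (lt_irrefl _)
        · rfl
      have := Set.ncard_le_ncard this
      rw [h, Set.ncard_singleton] at this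
      omega
    · have : {μ : ℝ | (μ = -3 ∨ μ = (n - 1) / 2 - 4 ∨ μ = (n - 1) / 2 - 4 + n) ∧
          (n - 1) / 2 - 4 + n < μ} = ∅ := by
        ext μ
        simp only [Set.mem_ofPred_eq, Set.mem_empty_iff_false, iff_false]
        rintro ⟨rfl | rfl | rfl, hμ⟩ <;> linarith
      rw [this, Set.ncard_empty] at h
      omega
  · rintro rfl
    refine ⟨Or.inl rfl, ?_⟩
    have : {μ : ℝ | (μ = -3 ∨ μ = (n - 1) / 2 - 4 ∨ μ = (n - 1) / 2 - 4 + n) ∧ -3 < μ} =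
        {(n - 1) / 2 - 4, (n - 1) / 2 - 4 + n} := by
      ext μ
      simp only [Set.mem_ofPred_eq, Set.mem_insert_iff, Set.mem_singleton_iff]
      constructor
      · rintro ⟨rfl | h, hμ⟩
        · exact absurd hμ (lt_irrefl _)
        · exact h
      · rintro (rfl | rfl)
        · exact ⟨Or.inr (Or.inl rfl), by linarith⟩
        · exact ⟨Or.inr (Or.inr rfl), by linarith⟩
    rw [this, Set.ncard_pair]
    linarith

/-- If all replication numbers are odd, a nowhere-zero vector in the kernel of `W_S` with entries
of absolute value at most two gives `m(2, Γ_S) = 3`. -/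
theorem isMinNZI_two_three [Nontrivial P] {m : ℕ} (hm : Odd m)
    (hc : Fintype.card P = 2 * m + 1) (hP : 3 < Fintype.card P) {u : S.blocks → ℤ}
    (h0 : ∀ T, u T ≠ 0) (h2 : ∀ T, |u T| ≤ 2) (hW : S.incidenceMatrix *ᵥ u = 0) :
    S.blockGraph.IsMinNZI 2 3 := by
  obtain ⟨x, y, hxy⟩ := exists_pair_ne P
  obtain ⟨T₀, ⟨hT₀, -⟩, -⟩ := S.existsUnique_block x y hxy
  have hvec : ∀ u : S.blocks → ℤ, (∀ T, u T ≠ 0) →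
      (S.incidenceMatrix *ᵥ u = 0 ↔ Module.End.HasEigenvector
        (Matrix.toLin' (S.blockGraph.adjMatrix ℝ)) (-3) fun T => (u T : ℝ)) := by
    intro u h0
    rw [Module.End.hasEigenvector_iff, Module.End.mem_eigenspace_iff,
      toLin_adjMatrix_eq_neg_three_smul_iff, realIncidenceMatrix_mulVec_intCast_eq_zero_iff]
    refine (and_iff_left fun h => h0 ⟨T₀, hT₀⟩ ?_).symm
    simpa using congrFun h ⟨T₀, hT₀⟩
  have hidx := S.isEigenvalueOfIndex_two_iff hP
    (Module.End.hasEigenvalue_of_hasEigenvector ((hvec u h0).1 hW))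
  have hmem : ∀ k, k ∈ S.blockGraph.nziEigenvectorNumbers 2 ↔ S.HasFlow k := by
    intro k
    constructor
    · rintro ⟨θ, hθ, v, hv0, hv, hk⟩
      rw [(hidx θ).1 hθ] at hv
      exact ⟨v, hv0, (hvec v hv0).2 hv, hk⟩
    · rintro ⟨v, hv0, hv, hk⟩
      exact ⟨-3, (hidx _).2 rfl, v, hv0, (hvec v hv0).1 hv, hk⟩
  refine ⟨(hmem 3).2 ?_, fun k hk => S.three_le_of_hasFlow x hm hc ((hmem k).1 hk)⟩
  rcases S.hasFlow_two_or_three_of_abs_le h0 h2 hW with h | h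
  · exact absurd (S.three_le_of_hasFlow x hm hc h) (by norm_num)
  · exact h

end

end SteinerTripleSystem

/-! ### Line weightings of binary projective spaces and their extension from a hyperplane -/

/-- A weighting of the lines `{x, y, x + y}` of the projective geometry of an elementary abelian
`2`-group by `±1, ±2`, given as a function of two points, with sum zero at each point. -/
structure IsLineFlow {V : Type} [AddCommGroup V] [Fintype V] (F : V → V → ℤ) : Prop where
  symm : ∀ x y, F x y = F y x
  third : ∀ x y, F x y = F x (x + y)
  eq_zero_iff : ∀ x y, F x y = 0 ↔ x = 0 ∨ y = 0 ∨ x = y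
  abs_le : ∀ x y, |F x y| ≤ 2
  sum_eq_zero : ∀ x, ∑ y, F x y = 0

/-- A weighting by `±1, ±2` of the lines `{(0, h), (1, a), (1, a + h)}` outside of a hyperplane,
with sum zero at each point. -/
structure IsAffineFlow {V : Type} [AddCommGroup V] [Fintype V] (G : V → V → ℤ) : Prop where
  add_left : ∀ h a, G h (h + a) = G h a
  eq_zero_iff : ∀ h a, G h a = 0 ↔ h = 0
  abs_le : ∀ h a, |G h a| ≤ 2
  sum_right : ∀ h, ∑ a, G h a = 0
  sum_left : ∀ a, ∑ h, G h a = 0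

/-- Join weights of the lines in a hyperplane and of the lines outside of it. -/
def joinFlows {V : Type} [AddCommGroup V] (F G : V → V → ℤ) (p q : ZMod 2 × V) : ℤ :=
  if p.1 = 0 then (if q.1 = 0 then F p.2 q.2 else G p.2 q.2)
  else (if q.1 = 0 then G q.2 p.2 else G (p.2 + q.2) p.2)

theorem ZMod.eq_zero_or_eq_one_of_two (s : ZMod 2) : s = 0 ∨ s = 1 := by
  revert s; decide

section

variable {V : Type} [AddCommGroup V] [Fintype V]

theorem IsLineFlow.join {F G : V → V → ℤ} (hF : IsLineFlow F) (hG : IsAffineFlow G)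
    (h2 : ∀ v : V, v + v = 0) : IsLineFlow (joinFlows F G) where
  symm := by
    rintro ⟨s, x⟩ ⟨t, y⟩
    rcases ZMod.eq_zero_or_eq_one_of_two s with rfl | rfl <;>
      rcases ZMod.eq_zero_or_eq_one_of_two t with rfl | rfl <;>
      simp only [joinFlows, one_ne_zero, if_true, if_false]
    · exact hF.symm x y
    · rw [← hG.add_left, add_right_comm, h2, zero_add, add_comm x y]
  third := by
    have h11 : (1 : ZMod 2) + 1 = 0 := by decide
    rintro ⟨s, x⟩ ⟨t, y⟩
    rcases ZMod.eq_zero_or_eq_one_of_two s with rfl | rfl <;>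
      rcases ZMod.eq_zero_or_eq_one_of_two t with rfl | rfl <;>
      simp only [joinFlows, one_ne_zero, if_true, if_false, Prod.mk_add_mk, zero_add, add_zero, h11]
    · exact hF.third x y
    · exact (hG.add_left x y).symm
    · rw [← add_assoc, h2, zero_add]
  eq_zero_iff := by
    have hadd : ∀ x y : V, x + y = 0 ↔ x = y := fun x y =>
      ⟨fun h => by rw [← add_zero x, ← h2 y, ← add_assoc, h, zero_add], fun h => by rw [h, h2]⟩
    rintro ⟨s, x⟩ ⟨t, y⟩
    rcases ZMod.eq_zero_or_eq_one_of_two s with rfl | rfl <;>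
      rcases ZMod.eq_zero_or_eq_one_of_two t with rfl | rfl <;>
      simp [joinFlows, hF.eq_zero_iff, hG.eq_zero_iff, hadd]
  abs_le := by
    rintro ⟨s, x⟩ ⟨t, y⟩
    simp only [joinFlows]
    split_ifs <;> first | exact hF.abs_le _ _ | exact hG.abs_le _ _
  sum_eq_zero := by
    rintro ⟨s, x⟩
    rw [Fintype.sum_prod_type]
    have h01 : ∀ f : ZMod 2 → ℤ, ∑ t, f t = f 0 + f 1 := fun f => Fin.sum_univ_two f
    rw [h01]
    rcases ZMod.eq_zero_or_eq_one_of_two s with rfl | rfl <;>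
      simp only [joinFlows, one_ne_zero, if_true, if_false]
    · rw [hF.sum_eq_zero, hG.sum_right, add_zero]
    -- A point outside the hyperplane lies only on outer lines; the substitution `h = x + y` turns
    -- the sum over the other outer points into `sum_left`.
    · rw [hG.sum_left, zero_add, ← hG.sum_left x]
      exact Equiv.sum_comp (Equiv.addLeft x) fun h => G h x

theorem IsLineFlow.comp_addEquiv {W : Type} [AddCommGroup W] [Fintype W] {F : V → V → ℤ}
    (hF : IsLineFlow F) (e : W ≃+ V) : IsLineFlow fun x y => F (e x) (e y) where
  symm x y := hF.symm _ _
  third x y := by rw [map_add]; exact hF.third _ _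
  eq_zero_iff x y := by simp [hF.eq_zero_iff]
  abs_le x y := hF.abs_le _ _
  sum_eq_zero x := by
    rw [← hF.sum_eq_zero (e x)]
    exact Equiv.sum_comp e.toEquiv fun y => F (e x) y

end

/-! ### Zero-sum weights and the affine flow -/

theorem Finset.exists_signs_sum {α : Type} [DecidableEq α] (s : Finset α) :
    ∃ c : α → ℤ, (∀ x, c x = 1 ∨ c x = -1) ∧ (∑ x ∈ s, c x = 0 ∨ ∑ x ∈ s, c x = 1) := by
  induction s using Finset.induction_on with
  | empty => exact ⟨fun _ => 1, fun _ => Or.inl rfl, Or.inl rfl⟩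
  | insert a s ha ih =>
    obtain ⟨c, hc, hs⟩ := ih
    have key : ∀ e : ℤ, ∑ x ∈ insert a s, Function.update c a e x = e + ∑ x ∈ s, c x := by
      intro e
      rw [Finset.sum_insert ha, Function.update_self]
      congr 1
      refine Finset.sum_congr rfl fun x hx => Function.update_of_ne ?_ _ _
      rintro rfl
      exact ha hx
    have hupd : ∀ e : ℤ, e = 1 ∨ e = -1 → ∀ x, Function.update c a e x = 1 ∨
        Function.update c a e x = -1 := by
      intro e he x
      by_cases hx : x = a
      · subst hx; simpa using he
      · simpa [hx] using hc x
    rcases hs with hs | hs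
    · exact ⟨_, hupd 1 (Or.inl rfl), Or.inr (by rw [key, hs]; rfl)⟩
    · exact ⟨_, hupd (-1) (Or.inr rfl), Or.inl (by rw [key, hs]; rfl)⟩

/-- If the signs sum to 1, one of them is `-1`, since otherwise `s` would be a singleton; replacing
that one by `-2` balances the sum. -/
theorem Finset.exists_weights_sum_eq_zero {α : Type} [DecidableEq α] (s : Finset α)
    (hs : s.card ≠ 1) : ∃ c : α → ℤ, (∀ x, c x ≠ 0) ∧ (∀ x, |c x| ≤ 2) ∧ ∑ x ∈ s, c x = 0 := by
  obtain ⟨c, hc, h0 | h1⟩ := s.exists_signs_sum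
  · refine ⟨c, fun x => ?_, fun x => ?_, h0⟩ <;> rcases hc x with h | h <;> rw [h] <;> norm_num
  · obtain ⟨a, ha, hca⟩ : ∃ a ∈ s, c a = -1 := by
      by_contra! hne
      rw [Finset.sum_congr rfl fun x hx => (hc x).resolve_right (hne x hx), Finset.sum_const,
        nsmul_eq_mul, mul_one] at h1
      exact hs (by exact_mod_cast h1)
    refine ⟨fun x => c x - if x = a then 1 else 0, fun x => ?_, fun x => ?_, ?_⟩
    · by_cases hx : x = a
      · subst hx; simp [hca]
      · rcases hc x with h | h <;> simp [hx, h]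
    · by_cases hx : x = a
      · subst hx; simp [hca]
      · rcases hc x with h | h <;> simp [hx, h]
    · simp [Finset.sum_sub_distrib, h1, ha]

/-- The sign character of `ZMod 2`. -/
def zmodTwoSign (z : ZMod 2) : ℤ := if z = 0 then 1 else -1

theorem zmodTwoSign_add_one (z : ZMod 2) : zmodTwoSign (z + 1) = -zmodTwoSign z := by
  revert z; decide

theorem abs_zmodTwoSign (z : ZMod 2) : |zmodTwoSign z| = 1 := by
  revert z; decide

/-- Every `h` is killed by one of the functionals `a i`, `a j`, `a i + a j`. Put `G h a = c h * (-1)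
^ ψ a` with `ψ` such a functional: `ψ h = 0` gives invariance under `a ↦ a + h`, and `ψ ≠ 0` makes
the sum over `a` vanish. Among the `h` sharing one `ψ`, the coefficients `c h` are chosen with sum
zero, so the sum over `h` vanishes too. -/
theorem exists_isAffineFlow {n : ℕ} {i j k : Fin n} (hij : i ≠ j) (hik : i ≠ k) (hjk : j ≠ k) :
    ∃ G : (Fin n → ZMod 2) → (Fin n → ZMod 2) → ℤ, IsAffineFlow G := by
  let fib : (Fin n → ZMod 2) → Fin 3 := fun h => if h i = 0 then 0 else if h j = 0 then 1 else 2
  let ψ : Fin 3 → (Fin n → ZMod 2) → ZMod 2 := fun t a => ![a i, a j, a i + a j] t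
  -- Translation by `e t` reverses the sign of the character given by `ψ t`.
  let e : Fin 3 → (Fin n → ZMod 2) := ![Pi.single i 1, Pi.single j 1, Pi.single i 1]
  have hψadd : ∀ t a b, ψ t (a + b) = ψ t a + ψ t b := by
    intro t a b
    fin_cases t <;> simp [ψ]
    ring
  have hψfib : ∀ h, ψ (fib h) h = 0 := by
    intro h
    by_cases hi : h i = 0
    · simp [ψ, fib, hi]
    · by_cases hj : h j = 0
      · simp [ψ, fib, hi, hj]
      · have hi' := (ZMod.eq_zero_or_eq_one_of_two _).resolve_left hi
        have hj' := (ZMod.eq_zero_or_eq_one_of_two _).resolve_left hj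
        simp [ψ, fib, hi', hj']
        decide
  have hψe : ∀ t, ψ t (e t) = 1 := by
    intro t
    fin_cases t <;> simp [ψ, e, hij, hij.symm]
  -- The third coordinate `k` does not affect `fib`, so flipping it yields a second element of each
  -- class.
  have hcard : ∀ t, (Finset.univ.filter fun h => h ≠ 0 ∧ fib h = t).card ≠ 1 := by
    intro t
    refine (Finset.one_lt_card_iff.2 ?_).ne'
    have hne : ∀ b : Fin n → ZMod 2, b ≠ b + Pi.single k 1 := by
      intro b h
      simpa using congrFun h k
    have hz : ∀ (b : Fin n → ZMod 2) l, b l = 1 → b ≠ 0 := by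
      rintro b l hb rfl
      simp at hb
    fin_cases t
    · refine ⟨Pi.single j 1, Pi.single j 1 + Pi.single k 1, ?_, ?_, hne _⟩ <;>
        refine Finset.mem_filter.2 ⟨Finset.mem_univ _, hz _ j ?_, ?_⟩ <;>
        simp [fib, hij, hik, hjk]
    · refine ⟨Pi.single i 1, Pi.single i 1 + Pi.single k 1, ?_, ?_, hne _⟩ <;>
        refine Finset.mem_filter.2 ⟨Finset.mem_univ _, hz _ i ?_, ?_⟩ <;>
        simp [fib, hik, hjk, hij.symm]
    · refine ⟨Pi.single i 1 + Pi.single j 1, Pi.single i 1 + Pi.single j 1 + Pi.single k 1,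
        ?_, ?_, hne _⟩ <;>
        refine Finset.mem_filter.2 ⟨Finset.mem_univ _, hz _ i ?_, ?_⟩ <;>
        simp [fib, hij, hik, hjk, hij.symm]
  choose c hc0 hc2 hcs using fun t => Finset.exists_weights_sum_eq_zero _ (hcard t)
  refine ⟨fun h a => if h = 0 then 0 else c (fib h) h * zmodTwoSign (ψ (fib h) a),
    ?_, ?_, ?_, ?_, ?_⟩
  · intro h a
    rw [hψadd, hψfib, zero_add]
  · intro h a
    have hs : zmodTwoSign (ψ (fib h) a) ≠ 0 := abs_ne_zero.1 (by rw [abs_zmodTwoSign]; norm_num)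
    by_cases hh : h = 0 <;> simp [hh, hc0, hs]
  · intro h a
    by_cases hh : h = 0
    · simp [hh]
    · simp only [hh, if_false]
      rw [abs_mul, abs_zmodTwoSign, mul_one]
      exact hc2 _ _
  · intro h
    by_cases hh : h = 0
    · simp [hh]
    · simp only [hh, if_false]
      have h1 := Equiv.sum_comp (Equiv.addRight (e (fib h)))
        fun a => c (fib h) h * zmodTwoSign (ψ (fib h) a)
      simp only [Equiv.coe_addRight, hψadd, hψe, zmodTwoSign_add_one, mul_neg,
        Finset.sum_neg_distrib] at h1
      omega
  · intro a
    rw [← Finset.sum_fiberwise Finset.univ fib]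
    refine Finset.sum_eq_zero fun t _ => ?_
    have h1 : ∑ h with fib h = t, (if h = 0 then 0 else c (fib h) h * zmodTwoSign (ψ (fib h) a)) =
        ∑ h with h ≠ 0 ∧ fib h = t, c t h * zmodTwoSign (ψ t a) := by
      rw [Finset.sum_filter, Finset.sum_filter]
      refine Finset.sum_congr rfl fun h _ => ?_
      by_cases hh : h = 0 <;> by_cases ht : fib h = t <;> simp [hh, ht]
    rw [h1, ← Finset.sum_mul, hcs, zero_mul]

/-! ### The base case, the induction and the Hamming systems -/

/-- Weights of the lines of the projective space of dimension three over `𝔽₂`, where the points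
are given by the binary digits of the indices. -/
def solidTable : Fin 16 → Fin 16 → ℤ :=
![![0, 0, 0, 0, 0, 0, 0, 0, 0, 0, 0, 0, 0, 0, 0, 0],
  ![0, 0, 1, 1, 1, 1, 2, 2, -1, -1, -1, -1, -1, -1, -1, -1],
  ![0, 1, 0, 1, -1, -1, -1, -1, -1, -1, -1, -1, 2, 1, 2, 1],
  ![0, 1, 1, 0, -1, -1, -1, -1, 1, 2, 2, 1, -1, -1, -1, -1],
  ![0, 1, -1, -1, 0, 1, -1, -1, -1, -1, 1, 2, -1, -1, 1, 2],
  ![0, 1, -1, -1, 1, 0, -1, -1, 2, 1, -1, -1, 1, 2, -1, -1],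
  ![0, 2, -1, -1, -1, -1, 0, 2, 1, 1, -1, -1, -1, -1, 1, 1],
  ![0, 2, -1, -1, -1, -1, 2, 0, -1, -1, 1, 1, 1, 1, -1, -1],
  ![0, -1, -1, 1, -1, 2, 1, -1, 0, -1, -1, 1, -1, 2, 1, -1],
  ![0, -1, -1, 2, -1, 1, 1, -1, -1, 0, 2, -1, 1, -1, -1, 1],
  ![0, -1, -1, 2, 1, -1, -1, 1, -1, 2, 0, -1, -1, 1, 1, -1],
  ![0, -1, -1, 1, 2, -1, -1, 1, 1, -1, -1, 0, 1, -1, -1, 2],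
  ![0, -1, 2, -1, -1, 1, -1, 1, -1, 1, -1, 1, 0, -1, 2, -1],
  ![0, -1, 1, -1, -1, 2, -1, 1, 2, -1, 1, -1, -1, 0, -1, 1],
  ![0, -1, 2, -1, 1, -1, 1, -1, 1, -1, 1, -1, 2, -1, 0, -1],
  ![0, -1, 1, -1, 2, -1, 1, -1, -1, 1, -1, 2, -1, 1, -1, 0]]

/-- The number with given binary digits. -/
def binaryIndex (x : Fin 4 → ZMod 2) : Fin 16 :=
  Fin.ofNat 16 (ZMod.val (x 0) + 2 * ZMod.val (x 1) + 4 * ZMod.val (x 2) + 8 * ZMod.val (x 3))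

theorem isLineFlow_solidTable :
    IsLineFlow fun x y : Fin 4 → ZMod 2 => solidTable (binaryIndex x) (binaryIndex y) where
  symm := by decide +kernel
  third := by decide +kernel
  eq_zero_iff := by decide +kernel
  abs_le := by decide +kernel
  sum_eq_zero := by decide +kernel

/-- The induction cannot start at `r = 3`: the incidence matrix of the Fano plane is nonsingular. -/
theorem exists_isLineFlow (r : ℕ) (hr : 4 ≤ r) :
    ∃ F : (Fin r → ZMod 2) → (Fin r → ZMod 2) → ℤ, IsLineFlow F := by
  induction r, hr using Nat.le_induction with
  | base => exact ⟨_, isLineFlow_solidTable⟩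
  | succ n hn ih =>
    obtain ⟨F, hF⟩ := ih
    obtain ⟨G, hG⟩ := exists_isAffineFlow (n := n) (i := ⟨0, by omega⟩) (j := ⟨1, by omega⟩)
      (k := ⟨2, by omega⟩) (by simp) (by simp) (by simp)
    let e : (Fin (n + 1) → ZMod 2) ≃+ ZMod 2 × (Fin n → ZMod 2) :=
      { (Fin.consEquiv fun _ => ZMod 2).symm with
        map_add' := fun _ _ => rfl }
    refine ⟨_, (hF.join hG fun v => ?_).comp_addEquiv e⟩
    ext l
    exact CharTwo.add_self_eq_zero _

theorem isMinNZI_hammingSTS {r : ℕ} (hr : 4 ≤ r) (H : Matrix (Fin r) (Fin (2 ^ r - 1)) (ZMod 2))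
    (hH : IsHammingCheckMatrix H) : (hammingSTS H hH).blockGraph.IsMinNZI 2 3 := by
  obtain ⟨F, hF⟩ := exists_isLineFlow r hr
  obtain ⟨r, rfl⟩ : ∃ s, r = s + 2 := ⟨r - 2, by omega⟩
  have hpow : 2 ^ (r + 2) = 2 * (2 * 2 ^ r) := by ring
  have hpos : 2 ^ 2 ≤ 2 ^ r := Nat.pow_le_pow_right (by norm_num) (by omega)
  have hcol : ∀ x, H.col x ≠ 0 := fun x => by
    have : H.col x ∈ {v | v ≠ 0} := hH.2 ▸ Set.mem_range_self x
    exact this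
  have himg : Finset.univ.image H.col = Finset.univ.erase 0 := by
    ext v
    have : v ∈ Set.range H.col ↔ v ∈ {v | v ≠ 0} := by rw [hH.2]
    simpa using this
  obtain ⟨u, h0, h2, hW⟩ := (hammingSTS H hH).exists_flow_of_pairFunction
    (fun x y => F (H.col x) (H.col y)) (fun x => (hF.eq_zero_iff _ _).2 (Or.inr (Or.inr rfl)))
    (fun x => by
      rw [← Finset.sum_image (f := F (H.col x)) (hH.1.injOn), himg,
        Finset.sum_erase _ ((hF.eq_zero_iff _ _).2 (Or.inr (Or.inl rfl))), hF.sum_eq_zero])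
    (fun T hT => by
      obtain ⟨h3, hs⟩ := (mem_weightThreeSupports H T).1 hT
      obtain ⟨a, b, c, hab, hac, hbc, rfl⟩ := Finset.card_eq_three.1 h3
      rw [Finset.sum_insert (by simp [hab, hac]), Finset.sum_pair hbc] at hs
      have hself : ∀ v : Fin (r + 2) → ZMod 2, v + v = 0 := fun v => by
        ext i; exact CharTwo.add_self_eq_zero _
      -- In characteristic two the third point is `w = u + v`, so this is `third`.
      have hperm : ∀ u v w : Fin (r + 2) → ZMod 2, u + (v + w) = 0 → F u v = F u w := by
        intro u v w h
        rw [hF.third u v]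
        congr 1
        rw [← add_zero (u + v), ← hself w, ← add_assoc, add_assoc u v w, h, zero_add]
      have e1 := hperm _ _ _ hs
      have e2 := hperm (H.col b) (H.col c) (H.col a) (by rw [← hs]; abel)
      have e3 := hperm (H.col c) (H.col a) (H.col b) (by rw [← hs]; abel)
      refine ⟨F (H.col a) (H.col b), ?_, hF.abs_le _ _, ?_⟩
      · rw [Ne, hF.eq_zero_iff]
        simp [hcol, hH.1.eq_iff, hab]
      · have s1 := hF.symm (H.col a) (H.col b)
        have s2 := hF.symm (H.col a) (H.col c)
        have s3 := hF.symm (H.col b) (H.col c)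
        simp only [Finset.mem_insert, Finset.mem_singleton]
        rintro x (rfl | rfl | rfl) y (rfl | rfl | rfl) hxy <;> first | exact absurd rfl hxy | omega)
  have : Nontrivial (Fin (2 ^ (r + 2) - 1)) := Fin.nontrivial_iff_two_le.2 (by omega)
  -- After the shift `r = s + 2` this is the replication number, visibly odd.
  refine (hammingSTS H hH).isMinNZI_two_three (m := 2 * 2 ^ r - 1) ?_ ?_ ?_ h0 h2 hW
  · exact ⟨2 ^ r - 1, by omega⟩
  · rw [Fintype.card_fin]; omega
  · rw [Fintype.card_fin]; omega

/-! ### Weights for the Bose systems -/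

namespace ZMod

variable {p : ℕ} [Fact p.Prime]

/-- Even signs on `ZMod p` whose sum over a set of representatives of the pairs `{d, -d}` other
than `{0}` and `{1, -1}` is `0` or `1`. -/
theorem exists_even_signs (hp : p ≠ 2) : ∃ c : ZMod p → ℤ, (∀ d, c d = 1 ∨ c d = -1) ∧
    (∀ d, c (-d) = c d) ∧ ∃ S : ℤ, (S = 0 ∨ S = 1) ∧
      ∑ d, (if d = 0 ∨ d = 1 ∨ d = -1 then 0 else c d) = 2 * S := by
  have hprime : p.Prime := Fact.out
  obtain ⟨m, hm⟩ := hprime.odd_of_ne_two hp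
  have hm1 : 1 ≤ m := by have := hprime.two_le; omega
  let s : Finset (ZMod p) := Finset.univ.filter fun d => 2 ≤ d.val ∧ d.val ≤ m
  obtain ⟨c, hc, hs⟩ := s.exists_signs_sum
  have hneg : ∀ d : ZMod p, d ≠ 0 → (-d).val = p - d.val := fun d hd => by
    rw [ZMod.neg_val, if_neg hd]
  have hone : ∀ d : ZMod p, d = 1 ↔ d.val = 1 := fun d => by
    rw [← (ZMod.val_injective p).eq_iff, ZMod.val_one]
  -- Evaluating at the representative in `[0, m]` makes the signs even, and `s` holds exactly one of
  -- `d, -d` for each `d ≠ 0, 1, -1`.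
  refine ⟨fun d => c (if d.val ≤ m then d else -d), fun d => hc _, fun d => ?_,
    ∑ x ∈ s, c x, hs, ?_⟩
  · by_cases hd : d = 0
    · simp [hd]
    · have h1 := hneg d hd
      have h2 := d.val_lt
      by_cases h : d.val ≤ m
      · have h3 : ¬ (-d).val ≤ m := by omega
        simp [h, h3]
      · have h3 : (-d).val ≤ m := by omega
        simp [h, h3]
  · have hpt : ∀ d : ZMod p, (if d = 0 ∨ d = 1 ∨ d = -1 then 0 else c (if d.val ≤ m then d else -d)) =
        (if d ∈ s then c d else 0) + if -d ∈ s then c (-d) else 0 := by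
      intro d
      simp only [s, Finset.mem_filter, Finset.mem_univ, true_and, hone, eq_neg_iff_add_eq_zero]
      have hn1 : d + 1 = 0 ↔ (-d).val = 1 := by
        rw [← hone, neg_eq_iff_add_eq_zero]
      by_cases hd : d = 0
      · simp [hd]
      · have h1 := hneg d hd
        have h2 := d.val_lt
        have h3 : d.val ≠ 0 := by rwa [Ne, ZMod.val_eq_zero]
        simp only [hd, false_or, hn1]
        split_ifs <;> omega
    rw [Finset.sum_congr rfl fun d _ => hpt d, Finset.sum_add_distrib,
      Fintype.sum_equiv (Equiv.neg (ZMod p)) (fun d => if -d ∈ s then c (-d) else 0)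
        (fun d => if d ∈ s then c d else 0) fun _ => rfl, ← two_mul]
    simp

/-- Parity of the least residue changes at every step except from `p - 1` to `0`, and of two
successive steps at most one wraps around. -/
theorem parity_val_not_constant (t : ZMod p) :
    ¬ ((Even (t - 1).val ↔ Even t.val) ∧ (Even (t + 1).val ↔ Even t.val)) := by
  have hprime : p.Prime := Fact.out
  rintro ⟨h1, h2⟩
  by_cases ht : t = 0
  · subst ht
    rw [zero_add, ZMod.val_one] at h2
    simp at h2
  · have h3 : 1 ≤ t.val := by
      have : t.val ≠ 0 := by rwa [Ne, ZMod.val_eq_zero]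
      omega
    rw [ZMod.val_sub (by rwa [ZMod.val_one]), ZMod.val_one] at h1
    rcases Nat.even_or_odd t.val with h | h
    · have := h1.2 h; rw [Nat.even_iff] at *; omega
    · have := mt h1.1 (Nat.not_even_iff_odd.2 h); rw [Nat.odd_iff] at h; rw [Nat.even_iff] at *; omega

/-- Weights `g d s` of the pairs with difference `d` and sum `s`, where `g 0 s` is the weight of
the vertical block at `s / 2`. -/
theorem exists_bose_weights (hp : p ≠ 2) : ∃ g : ZMod p → ZMod p → ℤ,
    (∀ d s, g d s ≠ 0) ∧ (∀ d s, |g d s| ≤ 2) ∧ (∀ d s, g (-d) s = g d s) ∧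
    ∀ s, 2 * ∑ d, g d (s - d) - g 0 s + ∑ d, g d s = 0 := by
  obtain ⟨c, hc, hceven, S, hS, hsum⟩ := exists_even_signs hp
  have h2 : (2 : ZMod p) ≠ 0 := by
    intro h
    have : ((2 : ℕ) : ZMod p) = 0 := by exact_mod_cast h
    rw [ZMod.natCast_eq_zero_iff] at this
    exact hp ((Nat.prime_dvd_prime_iff_eq Fact.out Nat.prime_two).1 this)
  have h11 : (1 : ZMod p) ≠ -1 := fun h => h2 (by linear_combination h)
  -- Three consecutive residues never share a parity. For `S = 0`, values `±1` by parity give triple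
  -- sums `±1`; for `S = 1`, values `-1, -2` give triple sums `-4, -5`, which `3 * S` shifts to `-1,
  -- -2`.
  obtain ⟨a, ha0, ha2, hv0, hv2⟩ : ∃ a : ZMod p → ℤ, (∀ t, a t ≠ 0) ∧ (∀ t, |a t| ≤ 2) ∧
      (∀ t, a (t - 1) + a t + a (t + 1) + 3 * S ≠ 0) ∧
      ∀ t, |a (t - 1) + a t + a (t + 1) + 3 * S| ≤ 2 := by
    rcases hS with rfl | rfl
    · refine ⟨fun t => if Even t.val then 1 else -1, fun t => ?_, fun t => ?_, fun t => ?_,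
        fun t => ?_⟩ <;> have := parity_val_not_constant t <;> dsimp only <;>
        split_ifs <;> simp_all
    · refine ⟨fun t => if Even t.val then -1 else -2, fun t => ?_, fun t => ?_, fun t => ?_,
        fun t => ?_⟩ <;> have := parity_val_not_constant t <;> dsimp only <;>
        split_ifs <;> simp_all
  -- The differences `±1` carry the free function `a`, the other nonzero ones carry signs
  -- independent of `s`. The identity then reads `2 * (g 0 s + a (s - 1) + a s + a (s + 1) + 3 * S)
  -- = 0`, which dictates `g 0 s`.
  let g : ZMod p → ZMod p → ℤ := fun d s =>
    if d = 0 then -(a (s - 1) + a s + a (s + 1) + 3 * S) else if d = 1 ∨ d = -1 then a s else c d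
  have hgsum : ∀ f : ZMod p → ZMod p,
      ∑ d, g d (f d) = g 0 (f 0) + a (f 1) + a (f (-1)) + 2 * S := by
    intro f
    have hpt : ∀ d, g d (f d) = (if d = 0 then g 0 (f 0) else 0) + (if d = 1 then a (f 1) else 0) +
        (if d = -1 then a (f (-1)) else 0) + if d = 0 ∨ d = 1 ∨ d = -1 then 0 else c d := by
      intro d
      by_cases hd0 : d = 0
      · subst hd0; simp
      · by_cases hd1 : d = 1
        · subst hd1; simp [g, h11]
        · by_cases hd2 : d = -1
          · subst hd2; simp [g, h11.symm]
          · simp [g, hd0, hd1, hd2]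
    rw [Finset.sum_congr rfl fun d _ => hpt d]
    simp only [Finset.sum_add_distrib, hsum]
    simp
  refine ⟨g, fun d s => ?_, fun d s => ?_, fun d s => ?_, fun s => ?_⟩
  · simp only [g]
    split_ifs
    · exact neg_ne_zero.2 (hv0 s)
    · exact ha0 s
    · rcases hc d with h | h <;> rw [h] <;> norm_num
  · simp only [g]
    split_ifs
    · rw [abs_neg]; exact hv2 s
    · exact ha2 s
    · rcases hc d with h | h <;> rw [h] <;> norm_num
  · have h3 : -d = 1 ∨ -d = -1 ↔ d = 1 ∨ d = -1 := by
      rw [neg_inj, neg_eq_iff_eq_neg, or_comm]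
    simp only [g, neg_eq_zero, hceven, h3]
  · rw [hgsum, hgsum fun _ => s]
    simp only [sub_zero, sub_neg_eq_add, g, if_true]
    ring

end ZMod

theorem hasFlow_boseSTS (p : ℕ) [Fact p.Prime] (hp : p ≠ 2) :
    (boseSTS p hp).HasFlow 2 ∨ (boseSTS p hp).HasFlow 3 := by
  obtain ⟨g, hg0, hg2, hgeven, hgsum⟩ := ZMod.exists_bose_weights hp
  have h2 : (2 : ZMod p) ≠ 0 := by
    intro h
    have : ((2 : ℕ) : ZMod p) = 0 := by exact_mod_cast h
    rw [ZMod.natCast_eq_zero_iff] at this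
    exact hp ((Nat.prime_dvd_prime_iff_eq Fact.out Nat.prime_two).1 this)
  have hn1 : ∀ i : ZMod 3, i + 1 ≠ i := by decide
  have hn2 : ∀ i : ZMod 3, i + 1 + 1 ≠ i := by decide
  have hn3 : ∀ i j : ZMod 3, i ≠ j → j ≠ i + 1 → i = j + 1 := by decide
  have hgsymm : ∀ x y s, g (x - y) s = g (y - x) s := fun x y s => by rw [← hgeven, neg_sub]
  -- The block through `(x, i)` and `(m, i + 1)` with `m ≠ x` has third point `(2m - x, i)`, so its
  -- level-`i` pair has difference `2(x - m)` and sum `2m`. For `m = x` the same formula gives the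
  -- vertical weight `g 0 (2x)`.
  let F : ZMod p × ZMod 3 → ZMod p × ZMod 3 → ℤ := fun a b =>
    if a.2 = b.2 then (if a.1 = b.1 then 0 else g (a.1 - b.1) (a.1 + b.1))
    else if b.2 = a.2 + 1 then g (2 * (a.1 - b.1)) (2 * b.1) else g (2 * (b.1 - a.1)) (2 * a.1)
  have hFsymm : ∀ a b, F a b = F b a := by
    rintro ⟨x, i⟩ ⟨y, j⟩
    by_cases hij : i = j
    · subst hij
      by_cases hxy : x = y
      · simp [hxy]
      · simp [F, hxy, Ne.symm hxy, hgsymm x y, add_comm x y]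
    · by_cases hj : j = i + 1
      · subst hj
        simp [F]
        intro h; exact absurd h.symm (hn2 i)
      · have hi := hn3 i j hij hj
        subst hi
        simp [F]
        intro h; exact absurd h.symm (hn2 j)
  obtain ⟨u, h0, h2, hW⟩ := (boseSTS p hp).exists_flow_of_pairFunction F (fun a => by simp [F])
    (fun a => by
      obtain ⟨z, i⟩ := a
      rw [Fintype.sum_prod_type_right]
      have hlev : ∀ f : ZMod 3 → ℤ, ∑ j, f j = f i + f (i + 1) + f (i + 1 + 1) := by
        intro f
        have h : ∀ i : ZMod 3, Finset.univ = ({i, i + 1, i + 1 + 1} : Finset (ZMod 3)) := by decide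
        rw [h i, Finset.sum_insert (by simp only [Finset.mem_insert, Finset.mem_singleton,
          (hn1 i).symm, (hn2 i).symm, or_self, not_false_eq_true]),
          Finset.sum_pair (hn1 (i + 1)).symm, add_assoc (f i)]
      rw [hlev]
      -- The correction removes `y = z`, which is not a pair; on the other two levels `y = z` stands
      -- for the vertical block and stays.
      have e0 : ∑ y, F (z, i) (y, i) = ∑ d, g d (2 * z - d) - g 0 (2 * z) := by
        have hpt : ∀ y, F (z, i) (y, i) =
            g (z - y) (2 * z - (z - y)) - if z = y then g 0 (2 * z) else 0 := by
          intro y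
          by_cases hzy : z = y
          · simp [F, hzy]
          · simp only [F, hzy, if_true, if_false, sub_zero]
            congr 1; ring
        rw [Finset.sum_congr rfl fun y _ => hpt y, Finset.sum_sub_distrib,
          Fintype.sum_equiv (Equiv.subLeft z) (fun y => g (z - y) (2 * z - (z - y)))
            (fun d => g d (2 * z - d)) fun _ => rfl]
        simp
      have e1 : ∑ y, F (z, i) (y, i + 1) = ∑ d, g d (2 * z - d) := by
        refine Fintype.sum_equiv ((Equiv.subLeft z).trans (Equiv.mulLeft₀ 2 h2)) _ _ fun y => ?_
        have hd : ((Equiv.subLeft z).trans (Equiv.mulLeft₀ 2 h2)) y = 2 * (z - y) := rfl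
        simp only [F, (hn1 i).symm, if_true, if_false, hd]
        congr 1; ring
      have e2 : ∑ y, F (z, i) (y, i + 1 + 1) = ∑ d, g d (2 * z) := by
        refine Fintype.sum_equiv ((Equiv.subRight z).trans (Equiv.mulLeft₀ 2 h2)) _ _ fun y => ?_
        have hd : ((Equiv.subRight z).trans (Equiv.mulLeft₀ 2 h2)) y = 2 * (y - z) := rfl
        simp only [F, (hn2 i).symm, hn1 (i + 1), if_false, hd]
      rw [e0, e1, e2, ← hgsum (2 * z)]
      ring)
    (fun T hT => by
      rcases (mem_boseBlocks p T).1 hT with ⟨x, rfl⟩ | ⟨x, y, i, hxy, rfl⟩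
      · refine ⟨g 0 (2 * x), hg0 _ _, hg2 _ _, ?_⟩
        rintro ⟨a, i⟩ ha ⟨b, j⟩ hb hab
        rw [mem_vertical] at ha hb
        dsimp only at ha hb
        subst ha hb
        have hij : i ≠ j := fun h => hab (by rw [h])
        simp [F, hij]
      · refine ⟨g (x - y) (x + y), hg0 _ _, hg2 _ _, ?_⟩
        have hm : 2 * ((x + y) / 2) = x + y := mul_div_cancel₀ _ h2
        have e1 : F (x, i) (y, i) = g (x - y) (x + y) := by simp [F, hxy]
        have e2 : F (x, i) ((x + y) / 2, i + 1) = g (x - y) (x + y) := by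
          simp only [F, (hn1 i).symm, if_true, if_false, mul_sub, hm]
          congr 1; ring
        have e3 : F (y, i) ((x + y) / 2, i + 1) = g (x - y) (x + y) := by
          simp only [F, (hn1 i).symm, if_true, if_false, mul_sub, hm]
          rw [hgsymm x y]
          congr 1; ring
        simp only [Finset.mem_insert, Finset.mem_singleton]
        rintro a (rfl | rfl | rfl) b (rfl | rfl | rfl) hab <;>
          first | exact absurd rfl hab | assumption | (rw [hFsymm]; assumption))
  exact (boseSTS p hp).hasFlow_two_or_three_of_abs_le h0 h2 hW

theorem mainTheorem11 :
    (∀ (r : ℕ) (_ : 4 ≤ r) (H : Matrix (Fin r) (Fin (2 ^ r - 1)) (ZMod 2))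
      (hH : IsHammingCheckMatrix H), (hammingSTS H hH).blockGraph.IsMinNZI 2 3) ∧
    (∀ (p : ℕ) [Fact p.Prime] (hp : p ≠ 2),
      (boseSTS p hp).HasFlow 2 ∨ (boseSTS p hp).HasFlow 3) := by
  exact ⟨fun _ hr H hH => isMinNZI_hammingSTS hr H hH, fun p _ hp => hasFlow_boseSTS p hp⟩
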